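/- A stochastic vector is a probability vector indexed by $\mathbb{N}$, and $\|p-q\|_{TV}=\frac12\sum_{x}|p_x-q_x|$. Let $A$ and $B$ be column-stochastic $\mathbb{N}\times\mathbb{N}$ matrices with entries $A(y\mid x)$, $B(y\mid x)$. The stationary distribution $\pi$ of $A$ is the unique stochastic vector with $A\pi=\pi$. The kernel $A$ is called $(G,\theta)$-geometrically ergodic, where $1\le G<\infty$ and $0\le\theta<1$, if it has a stationary distribution $\pi$ and $\sup_{x\in\mathbb{N}}\|A^{s-1}\delta_x-\pi\|_{TV}\le G\theta^{s-1}$ for all $s=1,2,\dots$. A hidden Markov chain with parameters $(p_1,A,B)$ is a sequence $Y_1,Y_2,\dots$ of $\mathbb{N}$-valued random variables such that for all $n\ge1$ and $y\in\mathbb{N}^n$ $$\mathbb{P}(Y_1=y_1,\dots,Y_n=y_n)=\sum_{x\in\mathbb{N}^n}p_1(x_1)\prod_{i=1}^{n-1}A(x_{i+1}\mid x_i)\prod_{i=1}^nB(y_i\mid x_i);$$ $p_1$ is the initial distribution of its underlying Markov chain. **Corollary.** Let $A$ be $(G,\theta)$-geometrically ergodic with stationary distribution $\pi$, let $\pi'$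 be any stochastic vector, and let $Y_1,Y_2,\dots$ be a (not necessarily stationary) hidden Markov chain with parameters $(\pi',A,B)$. Put $\rho=B\pi$, $\rho(E)=\sum_{y\in E}\rho_y$, and $$\hat\rho^{(n)}_y=\frac1n\sum_{i=1}^n\mathbf 1[Y_i=y],\qquad \hat\rho^{(n)}(E)=\frac1n\sum_{i=1}^n\mathbf 1[Y_i\in E]\qquad(y\in\mathbb{N},\ E\subseteq\mathbb{N}),$$ $$\gamma_n=\frac12\sqrt{\frac{1+2G\theta}{n(1-\theta)}},\qquad \Lambda_n(\rho)=\gamma_n\sum_{\rho_y\ge1/n}\sqrt{\rho_y}+\min\Big\{\gamma_n\sum_{\rho_y<1/n}\sqrt{\rho_y},\ \sum_{\rho_y<1/n}\rho_y\Big\},$$ where $\sum_{\rho_y<1/n}\sqrt{\rho_y}$ may be $+\infty$. Then for all $n\ge1$ and $\varepsilon>0$, $$\mathbb{P}\Big(\sup_{y\in\mathbb{N}}|\rho_y-\hat\rho^{(n)}_y|>\sqrt{\tfrac{1+2G\theta}{n(1-\theta)}}+\varepsilon\Big)\le\exp\Big(-\frac{n(1-\theta)^2\varepsilon^2}{2G^2}\Big)+\|\pi-\pi'\|_{TV}$$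 and $$\mathbb{P}\Big(\sup_{E\subseteq\mathbb{N}}|\rho(E)-\hat\rho^{(n)}(E)|>\Lambda_n(\rho)+\varepsilon\Big)\le\exp\Big(-\frac{n(1-\theta)^2\varepsilon^2}{2G^2}\Big)+\|\pi-\pi'\|_{TV}.$$ -/

import Mathlib

open MeasureTheory
open scoped ENNReal

/-- Total variation distance `‖p - q‖_TV = (1/2) ‖p - q‖₁` of two probability vectors on `ℕ`. -/
noncomputable def tvDist (p q : PMF ℕ) : ℝ :=
  (1 / 2) * ∑' x : ℕ, |(p x).toReal - (q x).toReal|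

/-! A column-stochastic `ℕ × ℕ` matrix is a family of probability vectors `A : ℕ → PMF ℕ`, with
`A x y = A(y | x)`; the product of the matrix `A` with a stochastic vector `p` is `p.bind A`. -/

/-- The stationary distribution: the unique stochastic vector with `A π = π`. -/
def IsStationaryDistribution (A : ℕ → PMF ℕ) (π : PMF ℕ) : Prop :=
  π.bind A = π ∧ ∀ μ : PMF ℕ, μ.bind A = μ → μ = π

/-- The law of the chain after `k` transitions from the state `x`, that is `A ^ k δ_x`, which is the
conditional law of `X_{k+1}` given `X_1 = x`. -/
noncomputable def stepLaw (A : ℕ → PMF ℕ) : ℕ → ℕ → PMF ℕ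
  | 0, x => PMF.pure x
  | k + 1, x => (stepLaw A k x).bind A

/-- The inverse mixing time `τ_s = sup_x ‖Law(X_s | X_1 = x) - π‖_TV`, for `s ≥ 1`. -/
noncomputable def inverseMixingTime (A : ℕ → PMF ℕ) (π : PMF ℕ) (s : ℕ) : ℝ :=
  ⨆ x : ℕ, tvDist (stepLaw A (s - 1) x) π

/-- The kernel `A`, with stationary distribution `π`, is `(G, θ)`-geometrically ergodic. -/
def GeometricallyErgodic (A : ℕ → PMF ℕ) (π : PMF ℕ) (G θ : ℝ) : Prop :=
  IsStationaryDistribution A π ∧ 1 ≤ G ∧ 0 ≤ θ ∧ θ < 1 ∧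
    ∀ s : ℕ, 1 ≤ s → inverseMixingTime A π s ≤ G * θ ^ (s - 1)

/-- The probability `p₁(x₁) ∏ A(x_{i+1} | x_i)` of a path of length `m + 1` of the Markov chain with
initial distribution `p₁` and transition kernel `A`. -/
noncomputable def markovLaw (p₁ : PMF ℕ) (A : ℕ → PMF ℕ) (m : ℕ) (x : Fin (m + 1) → ℕ) : ℝ≥0∞ :=
  p₁ (x 0) * ∏ i : Fin m, A (x i.castSucc) (x i.succ)

/-- The probability of the first `m + 1` observations `y` under the hidden Markov model with
underlying Markov chain `(p₁, A)` and emission probabilities `B`. -/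
noncomputable def hiddenMarkovLaw (p₁ : PMF ℕ) (A B : ℕ → PMF ℕ) (m : ℕ)
    (y : Fin (m + 1) → ℕ) : ℝ≥0∞ :=
  ∑' x : Fin (m + 1) → ℕ, markovLaw p₁ A m x * ∏ i : Fin (m + 1), B (x i) (y i)

/-- `Y` is a hidden Markov chain with parameters `(p₁, A, B)`. The observation `Y_{i+1}` of the
mathematical text is `Y i`. -/
def IsHiddenMarkovChain {Ω : Type*} [MeasurableSpace Ω] (P : Measure Ω) (Y : ℕ → Ω → ℕ)
    (p₁ : PMF ℕ) (A B : ℕ → PMF ℕ) : Prop :=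
  (∀ i, Measurable (Y i)) ∧
    ∀ (m : ℕ) (y : Fin (m + 1) → ℕ),
      P {ω | ∀ i : Fin (m + 1), Y i ω = y i} = hiddenMarkovLaw p₁ A B m y

/-- The empirical frequency of the value `y` among the first `n` observations. -/
noncomputable def empiricalFreq {Ω : Type*} (Y : ℕ → Ω → ℕ) (n : ℕ) (ω : Ω) (y : ℕ) : ℝ :=
  (1 / (n : ℝ)) * ∑ i ∈ Finset.range n, if Y i ω = y then 1 else 0

/-- The occupation frequency of the set `E` among the first `n` observations. -/
noncomputable def occupationFreq {Ω : Type*} (Y : ℕ → Ω → ℕ) (n : ℕ) (ω : Ω) (E : Set ℕ) : ℝ :=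
  (1 / (n : ℝ)) * ∑ i ∈ Finset.range n, E.indicator (fun _ => (1 : ℝ)) (Y i ω)

noncomputable def gammaCoeff (G θ : ℝ) (n : ℕ) : ℝ :=
  (1 / 2) * √((1 + 2 * G * θ) / (n * (1 - θ)))

/-- The quantity `Λ_n(ρ)`. It is `[0, ∞]`-valued because the sum of `√ρ_y` over `ρ_y < 1/n`, which
occurs inside the minimum, may diverge. -/
noncomputable def chernoffRate (G θ : ℝ) (n : ℕ) (ρ : PMF ℕ) : ℝ≥0∞ :=
  ENNReal.ofReal (gammaCoeff G θ n) *
      (∑' y : {y : ℕ // (n : ℝ≥0∞)⁻¹ ≤ ρ y}, ENNReal.ofReal (√(ρ y).toReal)) +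
    min
      (ENNReal.ofReal (gammaCoeff G θ n) *
        ∑' y : {y : ℕ // ρ y < (n : ℝ≥0∞)⁻¹}, ENNReal.ofReal (√(ρ y).toReal))
      (∑' y : {y : ℕ // ρ y < (n : ℝ≥0∞)⁻¹}, ρ y)

/-! Each supremum of deviations is a function `F` of the n observations that changes by at most 1/n
when one observation is altered. The proof bounds the mean of `F` under the stationary start, then
the upper fluctuation of `F` around that mean, then the price of another initial law.

Fluctuation: reveal the pairs (state, observation) one at a time. Two chains started at different
states are within 2Gθ^s in total variation after s steps, so the conditional mean of `F` oscillates
by at most 2G/(n(1-θ)) in the pair just revealed (`mean_obsLaw_sub_le`, resting on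
`abs_mean_obsLaw_stepLaw_sub_le`). Hoeffding's lemma at each step and the Chernoff bound give the
exponential term (`mean_exp_obsLaw_le`, `obsLaw_tail_le`).

Mean: under stationarity the frequency of y is unbiased, and its variance is at most
ρ_y(1+2Gθ)/(n(1-θ)) (`mean_obsLaw_sq_le`). This factor ρ_y is what makes the sums over y converge.
The pointwise supremum is at most the ℓ² norm of the deviations, whose squares sum to
(1+2Gθ)/(n(1-θ)) in mean. The supremum over sets is at most half the ℓ¹ norm, estimated term by term
by γ_n√ρ_y or by ρ_y.

Initial law: the probability of an event of the observations is the mean of a [0,1]-valued function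
of the first state, so replacing π by π' costs at most their total variation distance (`real_le`).
-/

/-! ### Expectations of bounded functions under discrete laws. -/

namespace PMF

variable {α β : Type*}

/-- The expectation of a real function under a discrete probability law. -/
noncomputable def mean (p : PMF α) (f : α → ℝ) : ℝ := ∑' a, (p a).toReal * f a

theorem summable_toReal (p : PMF α) : Summable fun a => (p a).toReal :=
  ENNReal.summable_toReal p.tsum_coe_ne_top

theorem tsum_toReal (p : PMF α) : ∑' a, (p a).toReal = 1 := by
  rw [← ENNReal.tsum_toReal_eq p.apply_ne_top, p.tsum_coe, ENNReal.toReal_one]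

/-- Boundedness keeps the series defining `mean` away from the default value 0 of a divergent
`tsum`; this is why the bounds `C` accompany the lemmas below. -/
theorem summable_mean (p : PMF α) {f : α → ℝ} {C : ℝ} (hf : ∀ a, |f a| ≤ C) :
    Summable fun a => (p a).toReal * f a := by
  refine Summable.of_norm_bounded (p.summable_toReal.mul_right C) fun a => ?_
  rw [Real.norm_eq_abs, abs_mul, abs_of_nonneg ENNReal.toReal_nonneg]
  exact mul_le_mul_of_nonneg_left (hf a) ENNReal.toReal_nonneg

theorem mean_add (p : PMF α) {f g : α → ℝ} {C C' : ℝ} (hf : ∀ a, |f a| ≤ C)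
    (hg : ∀ a, |g a| ≤ C') : p.mean (fun a => f a + g a) = p.mean f + p.mean g := by
  simp only [mean, mul_add]
  exact (p.summable_mean hf).tsum_add (p.summable_mean hg)

theorem mean_sub (p : PMF α) {f g : α → ℝ} {C C' : ℝ} (hf : ∀ a, |f a| ≤ C)
    (hg : ∀ a, |g a| ≤ C') : p.mean (fun a => f a - g a) = p.mean f - p.mean g := by
  simp only [mean, mul_sub]
  exact (p.summable_mean hf).tsum_sub (p.summable_mean hg)

theorem mean_const_mul (p : PMF α) (c : ℝ) (f : α → ℝ) :
    p.mean (fun a => c * f a) = c * p.mean f := by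
  simp only [mean, mul_left_comm _ c, tsum_mul_left]

@[simp] theorem mean_const (p : PMF α) (c : ℝ) : p.mean (fun _ => c) = c := by
  simp [mean, tsum_mul_right, tsum_toReal]

theorem mean_mono (p : PMF α) {f g : α → ℝ} {C C' : ℝ} (hf : ∀ a, |f a| ≤ C)
    (hg : ∀ a, |g a| ≤ C') (h : ∀ a, f a ≤ g a) : p.mean f ≤ p.mean g :=
  (p.summable_mean hf).tsum_le_tsum
    (fun a => mul_le_mul_of_nonneg_left (h a) ENNReal.toReal_nonneg) (p.summable_mean hg)

theorem mean_nonneg (p : PMF α) {f : α → ℝ} (h : ∀ a, 0 ≤ f a) : 0 ≤ p.mean f :=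
  tsum_nonneg fun a => mul_nonneg ENNReal.toReal_nonneg (h a)

theorem abs_mean_le (p : PMF α) {f : α → ℝ} {C : ℝ} (hf : ∀ a, |f a| ≤ C) :
    |p.mean f| ≤ C := by
  have hC : ∀ _ : α, |C| ≤ |C| := fun _ => le_rfl
  have hC' : ∀ _ : α, |-C| ≤ |-C| := fun _ => le_rfl
  rw [abs_le]
  constructor
  · simpa using p.mean_mono hC' hf fun a => (abs_le.1 (hf a)).1
  · simpa using p.mean_mono hf hC fun a => (abs_le.1 (hf a)).2

theorem mean_le_const (p : PMF α) {f : α → ℝ} {C D : ℝ} (hf : ∀ a, |f a| ≤ C)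
    (h : ∀ a, f a ≤ D) : p.mean f ≤ D := by
  simpa using p.mean_mono (g := fun _ => D) hf (fun _ => le_rfl) h

theorem mean_bind (p : PMF α) (q : α → PMF β) {f : β → ℝ} {C : ℝ} (hf : ∀ b, |f b| ≤ C) :
    (p.bind q).mean f = p.mean fun a => (q a).mean f := by
  have hsum : Summable (Function.uncurry fun (a : α) (b : β) =>
      (p a).toReal * (q a b).toReal * f b) := by
    have h1 : Summable fun z : α × β => (p z.1 * q z.1 z.2).toReal := by
      refine ENNReal.summable_toReal ?_
      rw [ENNReal.tsum_prod']
      simp [ENNReal.tsum_mul_left, PMF.tsum_coe]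
    refine Summable.of_norm_bounded (h1.mul_right C) fun z => ?_
    rw [ENNReal.toReal_mul, Function.uncurry, Real.norm_eq_abs, abs_mul,
      abs_of_nonneg (by positivity)]
    exact mul_le_mul_of_nonneg_left (hf _) (by positivity)
  calc (p.bind q).mean f = ∑' b, ∑' a, (p a).toReal * (q a b).toReal * f b := by
        refine tsum_congr fun b => ?_
        rw [bind_apply, ENNReal.tsum_toReal_eq
          fun a => ENNReal.mul_ne_top (p.apply_ne_top a) ((q a).apply_ne_top b), ← tsum_mul_right]
        simp only [ENNReal.toReal_mul]
    _ = ∑' a, ∑' b, (p a).toReal * (q a b).toReal * f b := hsum.tsum_comm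
    _ = _ := by simp only [mean, mul_assoc, tsum_mul_left]

theorem mean_pure (a : α) (f : α → ℝ) : (PMF.pure a).mean f = f a := by
  rw [mean, tsum_eq_single a]
  · simp
  · intro b hb
    simp [hb]

theorem mean_map (p : PMF α) (g : α → β) {f : β → ℝ} {C : ℝ} (hf : ∀ b, |f b| ≤ C) :
    (p.map g).mean f = p.mean fun a => f (g a) := by
  rw [map, mean_bind _ _ hf]
  simp [mean_pure]

theorem ofReal_mean (p : PMF α) {f : α → ℝ} {C : ℝ} (hf : ∀ a, |f a| ≤ C) (h : ∀ a, 0 ≤ f a) :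
    ENNReal.ofReal (p.mean f) = ∑' a, p a * ENNReal.ofReal (f a) := by
  rw [mean, ENNReal.ofReal_tsum_of_nonneg (fun a => mul_nonneg ENNReal.toReal_nonneg (h a))
    (p.summable_mean hf)]
  simp only [ENNReal.ofReal_mul ENNReal.toReal_nonneg, ENNReal.ofReal_toReal (p.apply_ne_top _)]

theorem mean_abs_le_sqrt (p : PMF α) {f : α → ℝ} {C : ℝ} (hf : ∀ a, |f a| ≤ C) :
    p.mean (fun a => |f a|) ≤ √(p.mean fun a => f a ^ 2) := by
  have hf' : ∀ a, |(|f a|)| ≤ C := by simpa using hf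
  have hf2 : ∀ a, |f a ^ 2| ≤ C ^ 2 := fun a => by
    rw [abs_pow]
    gcongr
    exact hf a
  set M := p.mean fun a => |f a| with hM
  have h1 : p.mean (fun a => f a ^ 2 - (2 * M) * |f a|) = p.mean (fun a => f a ^ 2) - 2 * M * M := by
    rw [mean_sub (C' := |2 * M| * C) _ hf2, mean_const_mul]
    intro a
    rw [abs_mul]
    exact mul_le_mul_of_nonneg_left (hf' a) (abs_nonneg _)
  have h2 : -(M ^ 2) ≤ p.mean (fun a => f a ^ 2 - (2 * M) * |f a|) := by
    rw [← p.mean_const (-(M ^ 2))]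
    refine p.mean_mono (C := |M| ^ 2) (C' := C ^ 2 + |2 * M| * C) (by simp) (fun a => ?_) fun a => ?_
    · refine (abs_sub _ _).trans (add_le_add (hf2 a) ?_)
      rw [abs_mul]
      exact mul_le_mul_of_nonneg_left (hf' a) (abs_nonneg _)
    · nlinarith [sq_nonneg (|f a| - M), sq_abs (f a)]
  exact Real.le_sqrt_of_sq_le (by nlinarith)

/-- Hoeffding's lemma for a discrete law. -/
theorem mean_exp_le (p : PMF α) {f : α → ℝ} {C D : ℝ} (hf : ∀ a, |f a| ≤ C)
    (hD : ∀ a b, f a - f b ≤ D) (t : ℝ) :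
    p.mean (fun a => Real.exp (t * (f a - p.mean f))) ≤ Real.exp (t ^ 2 * D ^ 2 / 8) := by
  let _ : MeasurableSpace α := ⊤
  have hi : ∀ g : α → ℝ, ∀ C, (∀ a, |g a| ≤ C) → ∫ a, g a ∂p.toMeasure = p.mean g := by
    intro g C hg
    rw [PMF.integral_eq_tsum]
    · rfl
    · exact Integrable.of_bound (measurable_from_top.aestronglyMeasurable) C (ae_of_all _ hg)
  obtain ⟨a₀⟩ : Nonempty α := ⟨p.support_nonempty.some⟩
  have hb : BddBelow (Set.range f) := ⟨-C, by rintro _ ⟨a, rfl⟩; exact (abs_le.1 (hf a)).1⟩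
  have : Nonempty α := ⟨a₀⟩
  -- Oscillation at most `D` places `f` in an interval of length `D` that starts at its infimum.
  have h := ProbabilityTheory.hasSubgaussianMGF_of_mem_Icc (X := f) (μ := p.toMeasure)
    (a := ⨅ a, f a) (b := (⨅ a, f a) + D) measurable_from_top.aemeasurable
    (ae_of_all _ fun a => ⟨ciInf_le hb a, by
      have : f a - D ≤ ⨅ a, f a := le_ciInf fun b => by linarith [hD a b]
      linarith⟩)
  have h2 := h.mgf_le t
  rw [ProbabilityTheory.mgf, hi f C hf] at h2
  rw [← hi _ (Real.exp (|t| * (C + C)))]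
  · refine h2.trans_eq ?_
    congr 1
    simp only [add_sub_cancel_left, NNReal.coe_pow, NNReal.coe_div, coe_nnnorm, Real.norm_eq_abs,
      NNReal.coe_ofNat, div_pow, sq_abs]
    ring
  · intro a
    rw [Real.abs_exp, Real.exp_le_exp]
    refine (le_abs_self _).trans ?_
    rw [abs_mul]
    refine mul_le_mul_of_nonneg_left ((abs_sub _ _).trans (add_le_add (hf a) ?_)) (abs_nonneg _)
    exact p.abs_mean_le hf

end PMF

/-! ### Total variation distance and mixing. -/

/-- Since `d` has total mass zero, `f` may be recentred at `c / 2`, where its modulus is at most `c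
/ 2`; this gives the factor 1/2 of the total variation distance. -/
theorem abs_tsum_mul_le {α : Type*} {d f : α → ℝ} {c : ℝ} (hd : Summable d) (h0 : ∑' a, d a = 0)
    (hf0 : ∀ a, 0 ≤ f a) (hf : ∀ a, f a ≤ c) :
    |∑' a, d a * f a| ≤ c * (1 / 2 * ∑' a, |d a|) := by
  have hb : ∀ a, |f a - c / 2| ≤ c / 2 := fun a => abs_le.2 ⟨by linarith [hf0 a], by linarith [hf a]⟩
  have hs : Summable fun a => |d a| * (c / 2) := hd.abs.mul_right _
  have hle : ∀ a, ‖d a * (f a - c / 2)‖ ≤ |d a| * (c / 2) := fun a => by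
    rw [Real.norm_eq_abs, abs_mul]
    exact mul_le_mul_of_nonneg_left (hb a) (abs_nonneg _)
  have hs1 : Summable fun a => d a * (f a - c / 2) := Summable.of_norm_bounded hs hle
  have e : ∑' a, d a * f a = ∑' a, d a * (f a - c / 2) := by
    have : ∀ a, d a * f a = d a * (f a - c / 2) + d a * (c / 2) := fun a => by ring
    simp_rw [this]
    rw [hs1.tsum_add (hd.mul_right _), tsum_mul_right, h0]
    ring
  rw [e, ← Real.norm_eq_abs]
  refine (tsum_of_norm_bounded hs.hasSum hle).trans_eq ?_
  rw [tsum_mul_right]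
  ring

theorem PMF.abs_mean_sub_mean_le (p q : PMF ℕ) {f : ℕ → ℝ} {c : ℝ} (hf0 : ∀ a, 0 ≤ f a)
    (hf : ∀ a, f a ≤ c) : |p.mean f - q.mean f| ≤ c * tvDist p q := by
  have hb : ∀ a, |f a| ≤ c := fun a => by rw [abs_of_nonneg (hf0 a)]; exact hf a
  rw [PMF.mean, PMF.mean, ← (p.summable_mean hb).tsum_sub (q.summable_mean hb)]
  simp_rw [← sub_mul]
  refine abs_tsum_mul_le (p.summable_toReal.sub q.summable_toReal) ?_ hf0 hf
  rw [p.summable_toReal.tsum_sub q.summable_toReal, p.tsum_toReal, q.tsum_toReal, sub_self]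

theorem tvDist_comm (p q : PMF ℕ) : tvDist p q = tvDist q p := by
  simp only [tvDist, abs_sub_comm]

theorem tvDist_triangle (p q r : PMF ℕ) : tvDist p r ≤ tvDist p q + tvDist q r := by
  have h1 := (p.summable_toReal.sub q.summable_toReal).abs
  have h2 := (q.summable_toReal.sub r.summable_toReal).abs
  rw [tvDist, tvDist, tvDist, ← mul_add, ← h1.tsum_add h2]
  refine mul_le_mul_of_nonneg_left (Summable.tsum_le_tsum (fun a => abs_sub_le _ _ _)
    (p.summable_toReal.sub r.summable_toReal).abs (h1.add h2)) (by norm_num)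

theorem tvDist_le_one (p q : PMF ℕ) : tvDist p q ≤ 1 := by
  have h : ∑' x, |(p x).toReal - (q x).toReal| ≤ ∑' x, ((p x).toReal + (q x).toReal) := by
    refine Summable.tsum_le_tsum (fun a => ?_)
      (p.summable_toReal.sub q.summable_toReal).abs (p.summable_toReal.add q.summable_toReal)
    refine (abs_sub _ _).trans_eq ?_
    rw [abs_of_nonneg ENNReal.toReal_nonneg, abs_of_nonneg ENNReal.toReal_nonneg]
  rw [p.summable_toReal.tsum_add q.summable_toReal, p.tsum_toReal, q.tsum_toReal] at h
  rw [tvDist]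
  linarith

namespace GeometricallyErgodic

variable {A : ℕ → PMF ℕ} {π : PMF ℕ} {G θ : ℝ}

theorem tvDist_le (hA : GeometricallyErgodic A π G θ) (k x : ℕ) :
    tvDist (stepLaw A k x) π ≤ G * θ ^ k := by
  refine le_trans ?_ (hA.2.2.2.2 (k + 1) (by omega))
  -- A real supremum dominates its terms only if the family is bounded; total variation is at most
  -- 1.
  exact le_ciSup (f := fun x => tvDist (stepLaw A k x) π)
    ⟨1, by rintro _ ⟨x, rfl⟩; exact tvDist_le_one _ _⟩ x

theorem tvDist_stepLaw_le (hA : GeometricallyErgodic A π G θ) (k x x' : ℕ) :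
    tvDist (stepLaw A k x) (stepLaw A k x') ≤ 2 * G * θ ^ k := by
  have h := tvDist_triangle (stepLaw A k x) π (stepLaw A k x')
  rw [tvDist_comm π] at h
  linarith [hA.tvDist_le k x, hA.tvDist_le k x']

end GeometricallyErgodic

/-! ### The law of the observations, by recursion on the first step. -/

/-- The joint law of the first state and the first observation. -/
noncomputable def firstStep (B : ℕ → PMF ℕ) (p : PMF ℕ) : PMF (ℕ × ℕ) :=
  p.bind fun x => (B x).map (Prod.mk x)

/-- The law of the first `m` observations when the first state has law `p`. -/
noncomputable def obsLaw (A B : ℕ → PMF ℕ) : (m : ℕ) → PMF ℕ → PMF (Fin m → ℕ)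
  | 0, _ => PMF.pure Fin.elim0
  | m + 1, p => (firstStep B p).bind fun z =>
      (obsLaw A B m (A z.1)).map (Fin.cons (α := fun _ => ℕ) z.2)

section Recursion

variable {A B : ℕ → PMF ℕ} {m : ℕ} {C : ℝ}

theorem mean_firstStep (p : PMF ℕ) {g : ℕ × ℕ → ℝ} (hg : ∀ z, |g z| ≤ C) :
    (firstStep B p).mean g = p.mean fun x => (B x).mean fun y => g (x, y) := by
  rw [firstStep, PMF.mean_bind _ _ hg]
  simp only [PMF.mean_map _ _ hg]

theorem mean_firstStep_fst (p : PMF ℕ) {g : ℕ → ℝ} (hg : ∀ x, |g x| ≤ C) :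
    ((firstStep B p).mean fun z => g z.1) = p.mean g := by
  rw [mean_firstStep p (C := C) fun z => hg z.1]
  simp

theorem mean_firstStep_snd (p : PMF ℕ) {g : ℕ → ℝ} (hg : ∀ x, |g x| ≤ C) :
    ((firstStep B p).mean fun z => g z.2) = (p.bind B).mean g := by
  rw [mean_firstStep p (C := C) fun z => hg z.2, PMF.mean_bind _ _ hg]

theorem mean_obsLaw_succ (p : PMF ℕ) {F : (Fin (m + 1) → ℕ) → ℝ} (hF : ∀ z, |F z| ≤ C) :
    (obsLaw A B (m + 1) p).mean F = (firstStep B p).mean fun z =>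
      (obsLaw A B m (A z.1)).mean fun w => F (Fin.cons z.2 w) := by
  rw [obsLaw, PMF.mean_bind _ _ hF]
  simp only [PMF.mean_map _ _ hF]

theorem mean_obsLaw_eq (p : PMF ℕ) {F : (Fin m → ℕ) → ℝ} (hF : ∀ z, |F z| ≤ C) :
    (obsLaw A B m p).mean F = p.mean fun x => (obsLaw A B m (PMF.pure x)).mean F := by
  cases m with
  | zero => simp [obsLaw]
  | succ m =>
    have h : ∀ z : ℕ × ℕ, |(obsLaw A B m (A z.1)).mean fun w => F (Fin.cons z.2 w)| ≤ C :=
      fun z => PMF.abs_mean_le _ fun w => hF _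
    simp only [mean_obsLaw_succ _ hF, mean_firstStep _ h, PMF.mean_pure]

theorem mean_obsLaw_bind (p : PMF ℕ) {F : (Fin m → ℕ) → ℝ} (hF : ∀ z, |F z| ≤ C) :
    (p.mean fun x => (obsLaw A B m (A x)).mean F) = (obsLaw A B m (p.bind A)).mean F := by
  rw [mean_obsLaw_eq (p.bind A) hF, PMF.mean_bind _ _ fun x => PMF.abs_mean_le _ hF]
  exact congrArg _ (funext fun x => mean_obsLaw_eq (A x) hF)

theorem mean_obsLaw_tail (p : PMF ℕ) {F : (Fin m → ℕ) → ℝ} (hF : ∀ z, |F z| ≤ C) :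
    ((obsLaw A B (m + 1) p).mean fun z => F (Fin.tail z)) = (obsLaw A B m (p.bind A)).mean F := by
  rw [mean_obsLaw_succ p fun z => hF _]
  simp only [Fin.tail_cons]
  rw [mean_firstStep_fst p fun x => PMF.abs_mean_le (obsLaw A B m (A x)) hF, mean_obsLaw_bind p hF]

/-- The law of the observations is a mixture, over the first state, of laws that do not depend on
`p`, so the two means are those of one [0, c]-valued function of the first state. -/
theorem abs_mean_obsLaw_sub_le (p q : PMF ℕ) {F : (Fin m → ℕ) → ℝ} {c : ℝ} (h0 : ∀ z, 0 ≤ F z)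
    (hc : ∀ z, F z ≤ c) :
    |(obsLaw A B m p).mean F - (obsLaw A B m q).mean F| ≤ c * tvDist p q := by
  have hF : ∀ z, |F z| ≤ c := fun z => by rw [abs_of_nonneg (h0 z)]; exact hc z
  rw [mean_obsLaw_eq p hF, mean_obsLaw_eq q hF]
  exact PMF.abs_mean_sub_mean_le p q (fun x => PMF.mean_nonneg _ h0)
    fun x => PMF.mean_le_const _ hF hc

end Recursion

/-! ### The bounded differences inequality. -/

/-- Changing one coordinate increases `F` by at most `c`. -/
def HammingLipschitz {m : ℕ} (c : ℝ) (F : (Fin m → ℕ) → ℝ) : Prop :=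
  ∀ z i a, F (Function.update z i a) ≤ F z + c

namespace HammingLipschitz

variable {m : ℕ} {c : ℝ}

theorem cons {F : (Fin (m + 1) → ℕ) → ℝ} (h : HammingLipschitz c F) (y : ℕ) :
    HammingLipschitz c fun w : Fin m → ℕ => F (Fin.cons y w) := fun w i a => by
  dsimp only
  rw [Fin.cons_update]
  exact h _ _ _

theorem cons_le {F : (Fin (m + 1) → ℕ) → ℝ} (h : HammingLipschitz c F) (y y' : ℕ)
    (w : Fin m → ℕ) : F (Fin.cons y w) ≤ F (Fin.cons y' w) + c := by
  simpa [Fin.update_cons_zero] using h (Fin.cons y' w) 0 y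

end HammingLipschitz

namespace GeometricallyErgodic

variable {A : ℕ → PMF ℕ} {π : PMF ℕ} {G θ : ℝ}

theorem sum_pow_le (hA : GeometricallyErgodic A π G θ) (m : ℕ) :
    ∑ s ∈ Finset.range m, θ ^ s ≤ 1 / (1 - θ) := by
  rw [one_div, ← tsum_geometric_of_lt_one hA.2.2.1 hA.2.2.2.1]
  exact (summable_geometric_of_lt_one hA.2.2.1 hA.2.2.2.1).sum_le_tsum _
    fun i _ => pow_nonneg hA.2.2.1 i

/-- A telescoping that peels off one observation at a time: the dependence of `F` on it has size `c`
and costs `c` times the distance between the current state laws, and what remains is a Lipschitz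
function of the later observations. -/
theorem abs_mean_obsLaw_stepLaw_sub_le (hA : GeometricallyErgodic A π G θ) (B : ℕ → PMF ℕ)
    {c : ℝ} (x x' : ℕ) {m : ℕ} : ∀ (k : ℕ) {F : (Fin m → ℕ) → ℝ} {C : ℝ},
    (∀ z, |F z| ≤ C) → HammingLipschitz c F →
    |(obsLaw A B m (stepLaw A k x)).mean F - (obsLaw A B m (stepLaw A k x')).mean F| ≤
      c * ∑ s ∈ Finset.range m, 2 * G * θ ^ (k + s) := by
  induction m with
  | zero => intro k F C hF hL; simp [obsLaw]
  | succ m ih =>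
    intro k F C hF hL
    have hbdd : ∀ w : Fin m → ℕ,
        BddBelow (Set.range fun a => F (Fin.cons (α := fun _ => ℕ) a w)) :=
      fun w => ⟨-C, by rintro _ ⟨a, rfl⟩; exact (abs_le.1 (hF _)).1⟩
    -- The infimum over the first coordinate stays Lipschitz with the same `c`, and `F` exceeds it
    -- by an amount in [0, c].
    set F' : (Fin m → ℕ) → ℝ := fun w => ⨅ a, F (Fin.cons (α := fun _ => ℕ) a w) with hF'
    have hle : ∀ a w, F' w ≤ F (Fin.cons a w) := fun a w => ciInf_le (hbdd w) a
    have hge : ∀ a w, F (Fin.cons a w) - c ≤ F' w := fun a w =>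
      le_ciInf fun b => by linarith [hL.cons_le a b w]
    have hFb : ∀ w, |F' w| ≤ C := fun w => abs_le.2
      ⟨le_ciInf fun b => (abs_le.1 (hF _)).1, (hle 0 w).trans (abs_le.1 (hF _)).2⟩
    have hL' : HammingLipschitz c F' := fun w i a => by
      rw [← sub_le_iff_le_add]
      refine le_ciInf fun b => ?_
      linarith [hle b (Function.update w i a), hL.cons b w i a]
    have h0 : ∀ z, 0 ≤ F z - F' (Fin.tail z) := fun z => by
      have := hle (z 0) (Fin.tail z)
      rw [Fin.cons_self_tail] at this
      linarith
    have h1 : ∀ z, F z - F' (Fin.tail z) ≤ c := fun z => by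
      have := hge (z 0) (Fin.tail z)
      rw [Fin.cons_self_tail] at this
      linarith
    have key : ∀ p, (obsLaw A B (m + 1) p).mean F =
        ((obsLaw A B (m + 1) p).mean fun z => F z - F' (Fin.tail z)) +
          (obsLaw A B m (p.bind A)).mean F' := fun p => by
      rw [PMF.mean_sub _ hF fun z => hFb (Fin.tail z), mean_obsLaw_tail p hFb]
      ring
    have hc : 0 ≤ c := (h0 0).trans (h1 0)
    have e1 := abs_mean_obsLaw_sub_le (A := A) (B := B) (stepLaw A k x) (stepLaw A k x') h0 h1
    have e2 := ih (k + 1) hFb hL'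
    have e3 := mul_le_mul_of_nonneg_left (hA.tvDist_stepLaw_le k x x') hc
    -- The term s = 0 pays for the first coordinate; the others are the induction hypothesis at time
    -- k + 1.
    rw [key, key, Finset.sum_range_succ', add_sub_add_comm]
    refine (abs_add_le _ _).trans ?_
    rw [add_comm]
    simp only [stepLaw, add_right_comm k 1, ← add_assoc] at e2 ⊢
    rw [mul_add]
    exact add_le_add e2 (e1.trans (by simpa using e3))

theorem mean_obsLaw_sub_le (hA : GeometricallyErgodic A π G θ) (B : ℕ → PMF ℕ) {m : ℕ} {c C : ℝ}
    (hc : 0 ≤ c) {F : (Fin (m + 1) → ℕ) → ℝ} (hF : ∀ z, |F z| ≤ C) (hL : HammingLipschitz c F)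
    (z z' : ℕ × ℕ) :
    ((obsLaw A B m (A z.1)).mean fun w => F (Fin.cons z.2 w)) -
      ((obsLaw A B m (A z'.1)).mean fun w => F (Fin.cons z'.2 w)) ≤ c * (2 * G / (1 - θ)) := by
  have h1 : ((obsLaw A B m (A z.1)).mean fun w => F (Fin.cons z.2 w)) ≤
      ((obsLaw A B m (A z.1)).mean fun w => F (Fin.cons z'.2 w)) + c := by
    have := PMF.mean_mono (obsLaw A B m (A z.1)) (f := fun w => F (Fin.cons z.2 w))
      (g := fun w => F (Fin.cons z'.2 w) + c) (C' := C + |c|) (fun w => hF _)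
      (fun w => (abs_add_le _ _).trans (add_le_add (hF _) le_rfl)) fun w => hL.cons_le _ _ w
    rwa [PMF.mean_add (C := C) (C' := |c|) _ (fun w => hF _) (fun _ => le_rfl),
      PMF.mean_const] at this
  -- With the observation already replaced at cost `c`, only the future differs: it starts one
  -- transition later, so the geometric sum begins at θ.
  have h2 := (le_abs_self _).trans (hA.abs_mean_obsLaw_stepLaw_sub_le B z.1 z'.1 1
    (F := fun w => F (Fin.cons z'.2 w)) (C := C) (fun w => hF _) (hL.cons _))
  simp only [stepLaw, PMF.pure_bind, pow_add, pow_one, ← mul_assoc, ← Finset.mul_sum] at h2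
  have hG := hA.2.1
  have hθ := hA.2.2.1
  have hθ1 : 0 < 1 - θ := by linarith [hA.2.2.2.1]
  have h3 := mul_le_mul_of_nonneg_left (hA.sum_pow_le m)
    (show 0 ≤ c * 2 * G * θ by have : 0 ≤ G := by linarith
                               positivity)
  -- The slack is `c * (2 * G - 1)`, nonnegative because G ≥ 1.
  have h4 : c + c * 2 * G * θ * (1 / (1 - θ)) ≤ c * (2 * G / (1 - θ)) := by
    rw [mul_one_div, mul_div_assoc', ← sub_nonneg]
    have : c * (2 * G) / (1 - θ) - (c + c * 2 * G * θ / (1 - θ)) = c * (2 * G - 1) := by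
      field_simp
      ring
    rw [this]
    exact mul_nonneg hc (by linarith)
  linarith

/-- The martingale argument as an induction: given the first state and observation the rest is again
a hidden chain, covered by the induction hypothesis, and Hoeffding's lemma treats the conditional
mean `h`, whose oscillation is at most `D`. Conditioning on the hidden state as well makes the
future independent of the past. -/
theorem mean_exp_obsLaw_le (hA : GeometricallyErgodic A π G θ) (B : ℕ → PMF ℕ) {c : ℝ}
    (hc : 0 ≤ c) (t : ℝ) {m : ℕ} : ∀ (p : PMF ℕ) {F : (Fin m → ℕ) → ℝ} {C : ℝ},
    (∀ z, |F z| ≤ C) → HammingLipschitz c F →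
    ((obsLaw A B m p).mean fun z => Real.exp (t * (F z - (obsLaw A B m p).mean F))) ≤
      Real.exp (m * (t ^ 2 * (c * (2 * G / (1 - θ))) ^ 2 / 8)) := by
  set D := c * (2 * G / (1 - θ)) with hD
  induction m with
  | zero => intro p F C hF hL; simp [obsLaw, PMF.mean_pure]
  | succ m ih =>
    intro p F C hF hL
    set h : ℕ × ℕ → ℝ := fun z => (obsLaw A B m (A z.1)).mean fun w => F (Fin.cons z.2 w) with hh
    have hhb : ∀ z, |h z| ≤ C := fun z => PMF.abs_mean_le _ fun w => hF _
    have hE : (obsLaw A B (m + 1) p).mean F = (firstStep B p).mean h := mean_obsLaw_succ p hF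
    have hEb : |(firstStep B p).mean h| ≤ C := PMF.abs_mean_le _ hhb
    have hexp : ∀ a b : ℝ, |a| ≤ C → |b| ≤ C →
        |Real.exp (t * (a - b))| ≤ Real.exp (|t| * (C + C)) := fun a b ha hb => by
      rw [Real.abs_exp, Real.exp_le_exp]
      refine (le_abs_self _).trans ?_
      rw [abs_mul]
      exact mul_le_mul_of_nonneg_left ((abs_sub _ _).trans (add_le_add ha hb)) (abs_nonneg _)
    rw [hE, mean_obsLaw_succ p fun z => hexp _ _ (hF z) hEb]
    set E := (firstStep B p).mean h
    set K := Real.exp (m * (t ^ 2 * D ^ 2 / 8)) with hK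
    have hin : ∀ z : ℕ × ℕ, ((obsLaw A B m (A z.1)).mean fun w =>
        Real.exp (t * (F (Fin.cons z.2 w) - E))) ≤ K * Real.exp (t * (h z - E)) := fun z => by
      have e : ∀ w : Fin m → ℕ, Real.exp (t * (F (Fin.cons z.2 w) - E)) =
          Real.exp (t * (h z - E)) * Real.exp (t * (F (Fin.cons z.2 w) - h z)) := fun w => by
        rw [← Real.exp_add]
        congr 1
        ring
      simp only [e, PMF.mean_const_mul]
      rw [mul_comm K]
      exact mul_le_mul_of_nonneg_left (ih (A z.1) (F := fun w => F (Fin.cons z.2 w))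
        (fun w => hF _) (hL.cons z.2)) (Real.exp_pos _).le
    calc _ ≤ (firstStep B p).mean fun z => K * Real.exp (t * (h z - E)) := by
          refine PMF.mean_mono _ (C := Real.exp (|t| * (C + C)))
            (C' := K * Real.exp (|t| * (C + C))) (fun z => ?_) (fun z => ?_) hin
          · exact PMF.abs_mean_le _ fun w => hexp _ _ (hF _) hEb
          · rw [abs_mul, abs_of_pos (Real.exp_pos _)]
            exact mul_le_mul_of_nonneg_left (hexp _ _ (hhb z) hEb) (Real.exp_pos _).le
      _ ≤ K * Real.exp (t ^ 2 * D ^ 2 / 8) := by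
          rw [PMF.mean_const_mul]
          exact mul_le_mul_of_nonneg_left (PMF.mean_exp_le _ hhb
            (fun z z' => hA.mean_obsLaw_sub_le B hc hF hL z z') t) (Real.exp_pos _).le
      _ = _ := by
          rw [hK, ← Real.exp_add]
          congr 1
          push_cast
          ring

/-- The bounded differences inequality for the observations of a hidden Markov chain. -/
theorem obsLaw_tail_le (hA : GeometricallyErgodic A π G θ) (B : ℕ → PMF ℕ) {n : ℕ} (hn : 1 ≤ n)
    (p : PMF ℕ) {F : (Fin n → ℕ) → ℝ} {C : ℝ} (hF : ∀ z, |F z| ≤ C)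
    (hL : HammingLipschitz (1 / n) F) {ε : ℝ} (hε : 0 < ε) {S : Set (Fin n → ℕ)}
    (hS : ∀ z ∈ S, (obsLaw A B n p).mean F + ε ≤ F z) :
    (obsLaw A B n p).mean (S.indicator 1) ≤
      Real.exp (-(n * (1 - θ) ^ 2 * ε ^ 2 / (2 * G ^ 2))) := by
  have hn0 : (0 : ℝ) < n := by exact_mod_cast hn
  have hθ1 : 0 < 1 - θ := by linarith [hA.2.2.2.1]
  have hG : 0 < G := by linarith [hA.2.1]
  set E := (obsLaw A B n p).mean F with hE
  have hEb : |E| ≤ C := PMF.abs_mean_le _ hF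
  -- The minimiser of -tε + t²G²/(2n(1-θ)²), the exponent obtained with c = 1/n.
  set t := n * (1 - θ) ^ 2 * ε / G ^ 2 with ht
  have ht0 : 0 < t := by positivity
  have hexp : ∀ z, |Real.exp (-(t * ε)) * Real.exp (t * (F z - E))| ≤
      Real.exp (-(t * ε)) * Real.exp (t * (C + C)) := fun z => by
    rw [abs_of_pos (by positivity)]
    gcongr
    linarith [(abs_le.1 (hF z)).2, (abs_le.1 hEb).1]
  have h1 : (obsLaw A B n p).mean (S.indicator 1) ≤
      (obsLaw A B n p).mean fun z => Real.exp (-(t * ε)) * Real.exp (t * (F z - E)) := by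
    refine PMF.mean_mono _ (C := 1) (fun z => ?_) hexp fun z => ?_
    · by_cases hz : z ∈ S <;> simp [hz]
    · by_cases hz : z ∈ S
      · rw [Set.indicator_of_mem hz, Pi.one_apply, ← Real.exp_add, Real.one_le_exp_iff]
        nlinarith [hS z hz]
      · rw [Set.indicator_of_notMem hz]
        positivity
  rw [PMF.mean_const_mul] at h1
  refine h1.trans ((mul_le_mul_of_nonneg_left
    (hA.mean_exp_obsLaw_le B (by positivity) t p hF hL) (Real.exp_pos _).le).trans_eq ?_)
  rw [← Real.exp_add]
  congr 1
  rw [ht]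
  field_simp
  ring

end GeometricallyErgodic

/-! ### Identification of the hidden Markov law with the recursive one. -/

section Law

variable {α : Type*} [MeasurableSpace α] [DiscreteMeasurableSpace α]

theorem PMF.toMeasure_real_eq_mean (p : PMF α) (S : Set α) :
    p.toMeasure.real S = p.mean (S.indicator 1) := by
  rw [measureReal_def, PMF.toMeasure_apply _ (MeasurableSet.of_discrete),
    ENNReal.tsum_toReal_eq, PMF.mean]
  · refine tsum_congr fun a => ?_
    by_cases ha : a ∈ S <;> simp [ha]
  · intro a
    by_cases ha : a ∈ S <;> simp [ha, p.apply_ne_top]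

end Law

section HiddenMarkov

variable {A B : ℕ → PMF ℕ}

theorem firstStep_apply (p : PMF ℕ) (x y : ℕ) : firstStep B p (x, y) = p x * B x y := by
  rw [firstStep, PMF.bind_apply, tsum_eq_single x]
  · rw [PMF.map_apply, tsum_eq_single y]
    · simp
    · intro b hb
      simp [Ne.symm hb]
  · intro x' hx
    rw [PMF.map_apply]
    simp [Ne.symm hx]

theorem obsLaw_succ_apply (m : ℕ) (p : PMF ℕ) (y : Fin (m + 1) → ℕ) :
    obsLaw A B (m + 1) p y =
      ∑' x, p x * (B x (y 0) * obsLaw A B m (A x) (Fin.tail y)) := by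
  have h : ∀ (q : PMF (Fin m → ℕ)) (b : ℕ), q.map (Fin.cons (α := fun _ => ℕ) b) y =
      if b = y 0 then q (Fin.tail y) else 0 := by
    intro q b
    rw [PMF.map_apply]
    split_ifs with hb
    · rw [tsum_eq_single (Fin.tail y)]
      · rw [hb, Fin.cons_self_tail, if_pos rfl]
      · intro w hw
        rw [if_neg]
        rintro rfl
        exact hw (Fin.tail_cons (α := fun _ => ℕ) b w).symm
    · refine ENNReal.tsum_eq_zero.2 fun w => if_neg ?_
      rintro rfl
      exact hb rfl
  rw [obsLaw, PMF.bind_apply, ENNReal.tsum_prod']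
  refine tsum_congr fun x => ?_
  rw [tsum_eq_single (y 0)]
  · rw [h, if_pos rfl, firstStep_apply, mul_assoc]
  · intro b hb
    rw [h, if_neg hb, mul_zero]

theorem tsum_fin_succ (m : ℕ) (f : (Fin (m + 1) → ℕ) → ℝ≥0∞) :
    ∑' x, f x = ∑' (a : ℕ) (w : Fin m → ℕ), f (Fin.cons a w) := by
  rw [← (Fin.consEquiv fun _ : Fin (m + 1) => ℕ).tsum_eq f, ENNReal.tsum_prod']
  rfl

/-- Summing over the first state factors the path sum into one emission and the same sum for the
shorter chain started from `A a`. -/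
theorem hiddenMarkovLaw_eq (m : ℕ) : ∀ (p : PMF ℕ) (y : Fin (m + 1) → ℕ),
    hiddenMarkovLaw p A B m y = obsLaw A B (m + 1) p y := by
  induction m with
  | zero =>
    intro p y
    rw [hiddenMarkovLaw, obsLaw_succ_apply, tsum_fin_succ]
    refine tsum_congr fun a => ?_
    rw [tsum_eq_single Fin.elim0 fun w hw => (hw (Subsingleton.elim _ _)).elim]
    have h : Fin.tail y = Fin.elim0 := Subsingleton.elim _ _
    simp [markovLaw, obsLaw, h]
  | succ m ih =>
    intro p y
    rw [hiddenMarkovLaw, obsLaw_succ_apply, tsum_fin_succ]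
    refine tsum_congr fun a => ?_
    rw [← ih, hiddenMarkovLaw, ← ENNReal.tsum_mul_left, ← ENNReal.tsum_mul_left]
    refine tsum_congr fun w => ?_
    rw [markovLaw, Fin.prod_univ_succ, markovLaw, Fin.prod_univ_succ]
    simp only [Fin.cons_zero, Fin.cons_succ, Fin.castSucc_zero, ← Fin.succ_castSucc, Fin.tail]
    ring

theorem IsHiddenMarkovChain.real_eq_mean {Ω : Type*} [MeasurableSpace Ω] {P : Measure Ω}
    {Y : ℕ → Ω → ℕ} {p : PMF ℕ} (hY : IsHiddenMarkovChain P Y p A B)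
    {n : ℕ} (hn : 1 ≤ n) (S : Set (Fin n → ℕ)) :
    P.real {ω | (fun i : Fin n => Y i ω) ∈ S} = (obsLaw A B n p).mean (S.indicator 1) := by
  obtain ⟨m, rfl⟩ := Nat.exists_eq_add_of_le' hn
  have hm : Measurable fun ω => fun i : Fin (m + 1) => Y i ω :=
    measurable_pi_lambda _ fun i => hY.1 i
  have h : P.map (fun ω => fun i : Fin (m + 1) => Y i ω) = (obsLaw A B (m + 1) p).toMeasure := by
    refine Measure.ext_of_singleton fun y => ?_
    rw [Measure.map_apply hm (measurableSet_singleton _),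
      PMF.toMeasure_apply_singleton _ _ (measurableSet_singleton _), ← hiddenMarkovLaw_eq, ← hY.2]
    congr 1
    ext ω
    simp [funext_iff]
  rw [← PMF.toMeasure_real_eq_mean, ← h, measureReal_def, measureReal_def,
    Measure.map_apply hm MeasurableSet.of_discrete]
  rfl

end HiddenMarkov

/-! ### Mean and variance of the occupation counts. -/

/-- The indicator of `y` centered by its probability under `ρ`. -/
noncomputable def centeredIndicator (ρ : PMF ℕ) (y a : ℕ) : ℝ :=
  (if a = y then 1 else 0) - (ρ y).toReal

theorem PMF.toReal_le_one {α : Type*} (p : PMF α) (a : α) : (p a).toReal ≤ 1 :=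
  ENNReal.toReal_le_of_le_ofReal zero_le_one (by simpa using p.coe_le_one a)

theorem PMF.mean_ite_eq (p : PMF ℕ) (y : ℕ) :
    (p.mean fun a => if a = y then 1 else 0) = (p y).toReal := by
  rw [PMF.mean, tsum_eq_single y]
  · simp
  · intro b hb
    simp [hb]

theorem abs_ite_le_one (P : Prop) [Decidable P] : |(if P then 1 else 0 : ℝ)| ≤ 1 := by
  split_ifs <;> simp

theorem abs_centeredIndicator_le (ρ : PMF ℕ) (y a : ℕ) : |centeredIndicator ρ y a| ≤ 1 := by
  have h1 := ρ.toReal_le_one y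
  have h0 : 0 ≤ (ρ y).toReal := ENNReal.toReal_nonneg
  rw [centeredIndicator, abs_le]
  split_ifs <;> constructor <;> linarith

theorem mean_centeredIndicator (p ρ : PMF ℕ) (y : ℕ) :
    p.mean (centeredIndicator ρ y) = (p y).toReal - (ρ y).toReal := by
  unfold centeredIndicator
  rw [PMF.mean_sub p (C := 1) (C' := |(ρ y).toReal|) (fun a => abs_ite_le_one _) fun _ => le_rfl,
    PMF.mean_ite_eq, PMF.mean_const]

theorem abs_sum_fin_le {m : ℕ} {g : ℕ → ℝ} (hg : ∀ a, |g a| ≤ 1) (z : Fin m → ℕ) :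
    |∑ i, g (z i)| ≤ m := by
  refine (Finset.abs_sum_le_sum_abs _ _).trans ?_
  refine (Finset.sum_le_sum fun i _ => hg (z i)).trans_eq ?_
  simp

theorem mean_obsLaw_sum_succ {A B : ℕ → PMF ℕ} {m : ℕ} (p : PMF ℕ) {g : ℕ → ℝ}
    (hg : ∀ a, |g a| ≤ 1) :
    ((obsLaw A B (m + 1) p).mean fun z => ∑ i, g (z i)) =
      (p.bind B).mean g + (obsLaw A B m (p.bind A)).mean fun z => ∑ i, g (z i) := by
  rw [← mean_obsLaw_tail p (abs_sum_fin_le hg), ← mean_firstStep_snd p hg]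
  have : ((firstStep B p).mean fun z => g z.2) =
      (obsLaw A B (m + 1) p).mean fun z => g (z 0) := by
    rw [mean_obsLaw_succ p fun z => hg _]
    simp
  rw [this, ← PMF.mean_add _ (fun z => hg _) fun z => abs_sum_fin_le hg _]
  simp only [Fin.sum_univ_succ, Fin.tail]

theorem mean_obsLaw_centered {A B : ℕ → PMF ℕ} {π : PMF ℕ} (hπ : π.bind A = π) (y m : ℕ) :
    ((obsLaw A B m π).mean fun z => ∑ i, centeredIndicator (π.bind B) y (z i)) = 0 := by
  induction m with
  | zero => simp
  | succ m ih =>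
    rw [mean_obsLaw_sum_succ _ (abs_centeredIndicator_le _ _), hπ, ih, mean_centeredIndicator,
      sub_self, add_zero]

namespace GeometricallyErgodic

variable {A : ℕ → PMF ℕ} {π : PMF ℕ} {G θ : ℝ}

/-- Each summand has mean P(Y = y) - ρ_y, a difference of means of the [0,1]-valued function B(y |
·) under the state law and under π, hence at most their total variation distance. -/
theorem abs_mean_obsLaw_centered_le (hA : GeometricallyErgodic A π G θ) (B : ℕ → PMF ℕ)
    (x y m : ℕ) : ∀ k, |(obsLaw A B m (stepLaw A k x)).mean fun z =>
      ∑ i, centeredIndicator (π.bind B) y (z i)| ≤ ∑ s ∈ Finset.range m, G * θ ^ (k + s) := by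
  induction m with
  | zero => simp
  | succ m ih =>
    intro k
    rw [mean_obsLaw_sum_succ _ (abs_centeredIndicator_le _ _), Finset.sum_range_succ']
    have h1 : |((stepLaw A k x).bind B).mean (centeredIndicator (π.bind B) y)| ≤ G * θ ^ k := by
      rw [mean_centeredIndicator, ← PMF.mean_ite_eq, ← PMF.mean_ite_eq,
        PMF.mean_bind _ _ (fun a => abs_ite_le_one _), PMF.mean_bind _ _ (fun a => abs_ite_le_one _)]
      simp only [PMF.mean_ite_eq]
      refine (PMF.abs_mean_sub_mean_le _ _ (fun a => ENNReal.toReal_nonneg)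
        fun a => (B a).toReal_le_one y).trans ?_
      rw [one_mul]
      exact hA.tvDist_le k x
    have h2 := ih (k + 1)
    simp only [stepLaw, add_right_comm k 1, ← add_assoc] at h2 ⊢
    rw [add_comm]
    exact (abs_add_le _ _).trans (add_le_add h2 h1)

/-- Expand (g + S)² with g the first centred indicator. The cross term involves the conditional mean
`M` of S given the first state, which has π-mean zero and modulus at most `K`. Centring removes the
-r part of g, so only the indicator part survives, contributing at most 2Kr; the bound thus stays
proportional to r. -/
theorem mean_obsLaw_sq_le (hA : GeometricallyErgodic A π G θ) (B : ℕ → PMF ℕ) (y m : ℕ) :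
    ((obsLaw A B m π).mean fun z => (∑ i, centeredIndicator (π.bind B) y (z i)) ^ 2) ≤
      m * (((π.bind B) y).toReal * (1 + 2 * (G * θ / (1 - θ)))) := by
  have hg := abs_centeredIndicator_le (π.bind B) y
  set r := ((π.bind B) y).toReal with hr
  have hr0 : 0 ≤ r := ENNReal.toReal_nonneg
  have hr1 : r ≤ 1 := PMF.toReal_le_one _ _
  set K := G * θ / (1 - θ) with hK
  have hθ1 : 0 < 1 - θ := by linarith [hA.2.2.2.1]
  have hG : 0 ≤ G := by linarith [hA.2.1]
  have hKn : 0 ≤ K := div_nonneg (mul_nonneg hG hA.2.2.1) hθ1.le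
  induction m with
  | zero => simp
  | succ m ih =>
    set S : (Fin m → ℕ) → ℝ := fun z => ∑ i, centeredIndicator (π.bind B) y (z i) with hS
    have hSb : ∀ z, |S z| ≤ m := abs_sum_fin_le hg
    have hS2b : ∀ z, |S z ^ 2| ≤ (m : ℝ) ^ 2 := fun z => by
      rw [abs_pow]
      gcongr
      exact hSb z
    set M : ℕ → ℝ := fun x => (obsLaw A B m (A x)).mean S with hM
    set Q : ℕ → ℝ := fun x => (obsLaw A B m (A x)).mean fun z => S z ^ 2 with hQ
    have hQb : ∀ x, |Q x| ≤ (m : ℝ) ^ 2 := fun x => PMF.abs_mean_le _ hS2b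
    have hMK : ∀ x, |M x| ≤ K := fun x => by
      have h := hA.abs_mean_obsLaw_centered_le B x y m 1
      simp only [stepLaw, PMF.pure_bind, pow_add, pow_one, ← mul_assoc, ← Finset.mul_sum] at h
      refine h.trans ((mul_le_mul_of_nonneg_left (hA.sum_pow_le m)
        (mul_nonneg hG hA.2.2.1)).trans_eq ?_)
      rw [hK, mul_one_div]
    have hM0 : π.mean M = 0 := by
      rw [mean_obsLaw_bind π hSb, hA.1.1]
      exact mean_obsLaw_centered hA.1.1 y m
    have hQE : π.mean Q = (obsLaw A B m π).mean fun z => S z ^ 2 := by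
      rw [mean_obsLaw_bind π hS2b, hA.1.1]
    have hin : ∀ z : ℕ × ℕ, ((obsLaw A B m (A z.1)).mean fun w =>
        (∑ i, centeredIndicator (π.bind B) y (Fin.cons (α := fun _ => ℕ) z.2 w i)) ^ 2) =
        centeredIndicator (π.bind B) y z.2 ^ 2 +
          (2 * centeredIndicator (π.bind B) y z.2 * M z.1 + Q z.1) := fun z => by
      have e : ∀ w : Fin m → ℕ,
          (∑ i, centeredIndicator (π.bind B) y (Fin.cons (α := fun _ => ℕ) z.2 w i)) ^ 2 =
          centeredIndicator (π.bind B) y z.2 ^ 2 +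
          (2 * centeredIndicator (π.bind B) y z.2 * S w + S w ^ 2) := fun w => by
        rw [Fin.sum_univ_succ]
        simp only [Fin.cons_zero, Fin.cons_succ, hS]
        ring
      have hb2 : ∀ w, |2 * centeredIndicator (π.bind B) y z.2 * S w| ≤
          |2 * centeredIndicator (π.bind B) y z.2| * m := fun w => by
        rw [abs_mul]
        exact mul_le_mul_of_nonneg_left (hSb w) (abs_nonneg _)
      simp only [e]
      rw [PMF.mean_add _ (fun _ => le_rfl)
        (fun w => (abs_add_le _ _).trans (add_le_add (hb2 w) (hS2b w))),
        PMF.mean_add _ hb2 hS2b, PMF.mean_const, PMF.mean_const_mul]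
    have hbd : ∀ z : Fin (m + 1) → ℕ,
        |(∑ i, centeredIndicator (π.bind B) y (z i)) ^ 2| ≤ ((m + 1 : ℕ) : ℝ) ^ 2 := fun z => by
      rw [abs_pow]
      gcongr
      exact abs_sum_fin_le hg z
    rw [mean_obsLaw_succ π hbd]
    -- `M` is bounded by `K` only where the indicator is 1; the term -2rM is kept exact because it
    -- averages to zero.
    have hU : ∀ z : ℕ × ℕ, centeredIndicator (π.bind B) y z.2 ^ 2 +
          (2 * centeredIndicator (π.bind B) y z.2 * M z.1 + Q z.1) ≤
        (1 - 2 * r + 2 * K) * (if z.2 = y then 1 else 0) + (r ^ 2 + (Q z.1 - 2 * r * M z.1)) := by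
      intro z
      have h1 := (abs_le.1 (hMK z.1)).2
      rw [centeredIndicator, ← hr]
      split_ifs <;> nlinarith
    have hb1 : ∀ z : ℕ × ℕ, |(1 - 2 * r + 2 * K) * (if z.2 = y then 1 else 0 : ℝ)| ≤
        |1 - 2 * r + 2 * K| * 1 := fun z => by
      rw [abs_mul]
      exact mul_le_mul_of_nonneg_left (abs_ite_le_one _) (abs_nonneg _)
    have hb3 : ∀ x, |2 * r * M x| ≤ |2 * r| * K := fun x => by
      rw [abs_mul]
      exact mul_le_mul_of_nonneg_left (hMK x) (abs_nonneg _)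
    have hb4 : ∀ x, |Q x - 2 * r * M x| ≤ (m : ℝ) ^ 2 + |2 * r| * K := fun x =>
      (abs_sub _ _).trans (add_le_add (hQb x) (hb3 x))
    have hb5 : ∀ z : ℕ × ℕ, |r ^ 2 + (Q z.1 - 2 * r * M z.1)| ≤
        |r ^ 2| + ((m : ℝ) ^ 2 + |2 * r| * K) := fun z =>
      (abs_add_le _ _).trans (add_le_add le_rfl (hb4 _))
    have hb0 : ∀ z : ℕ × ℕ, |(obsLaw A B m (A z.1)).mean fun w =>
        (∑ i, centeredIndicator (π.bind B) y (Fin.cons (α := fun _ => ℕ) z.2 w i)) ^ 2| ≤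
        ((m + 1 : ℕ) : ℝ) ^ 2 := fun z =>
      PMF.abs_mean_le _ fun w => hbd (Fin.cons (α := fun _ => ℕ) z.2 w)
    refine (PMF.mean_mono _ hb0
      (fun z => (abs_add_le _ _).trans (add_le_add (hb1 z) (hb5 z)))
      (fun z => (hin z).trans_le (hU z))).trans ?_
    rw [PMF.mean_add _ hb1 hb5, PMF.mean_const_mul,
      PMF.mean_add _ (f := fun _ => r ^ 2) (C := |r ^ 2|) (C' := (m : ℝ) ^ 2 + |2 * r| * K)
        (g := fun z : ℕ × ℕ => Q z.1 - 2 * r * M z.1) (fun _ => le_rfl) (fun z => hb4 z.1),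
      PMF.mean_const, mean_firstStep_snd π (g := fun a => if a = y then 1 else 0) (fun a => abs_ite_le_one _),
      PMF.mean_ite_eq, mean_firstStep_fst π (g := fun x => Q x - 2 * r * M x) hb4, PMF.mean_sub _ hQb hb3, PMF.mean_const_mul, hM0,
      hQE, ← hr]
    push_cast
    nlinarith

end GeometricallyErgodic

/-! ### Suprema of deviations as functions of the sample. -/

theorem ENNReal.ofReal_mean_le_tsum {α ι : Type*} (p : PMF α) {f : α → ℝ} {g : ι → α → ℝ}
    {C D : ℝ} (hf : ∀ a, |f a| ≤ C) (hf0 : ∀ a, 0 ≤ f a) (hg : ∀ j a, |g j a| ≤ D)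
    (hg0 : ∀ j a, 0 ≤ g j a)
    (h : ∀ a, ENNReal.ofReal (f a) ≤ ∑' j, ENNReal.ofReal (g j a)) :
    ENNReal.ofReal (p.mean f) ≤ ∑' j, ENNReal.ofReal (p.mean (g j)) := by
  rw [p.ofReal_mean hf hf0]
  calc _ ≤ ∑' a, ∑' j, p a * ENNReal.ofReal (g j a) :=
        ENNReal.tsum_le_tsum fun a => by
          rw [ENNReal.tsum_mul_left]
          exact mul_le_mul_right (h a) _
    _ = ∑' j, ∑' a, p a * ENNReal.ofReal (g j a) := ENNReal.tsum_comm
    _ = _ := tsum_congr fun j => (p.ofReal_mean (hg j) (hg0 j)).symm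

section Deviation

variable {ι : Type*} {n : ℕ}

/-- The average of `f` over the sample `z`. -/
noncomputable def sampleMean (f : ℕ → ℝ) (z : Fin n → ℕ) : ℝ := 1 / (n : ℝ) * ∑ i, f (z i)

/-- The maximal deviation of the sample averages of a family of functions from given values. -/
noncomputable def maxDeviation (f : ι → ℕ → ℝ) (r : ι → ℝ) (z : Fin n → ℕ) : ℝ :=
  ⨆ j, |r j - sampleMean (f j) z|

theorem sampleMean_nonneg {f : ℕ → ℝ} (h0 : ∀ a, 0 ≤ f a) (z : Fin n → ℕ) :
    0 ≤ sampleMean f z :=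
  mul_nonneg (by positivity) (Finset.sum_nonneg fun i _ => h0 _)

theorem sampleMean_le_one {f : ℕ → ℝ} (h1 : ∀ a, f a ≤ 1) (z : Fin n → ℕ) :
    sampleMean f z ≤ 1 := by
  have h : ∑ i, f (z i) ≤ n := by
    simpa using Finset.sum_le_sum fun i (_ : i ∈ Finset.univ) => h1 (z i)
  rw [sampleMean, one_div_mul_eq_div]
  exact div_le_one_of_le₀ h (by positivity)

theorem abs_sampleMean_update_sub_le {f : ℕ → ℝ} (h0 : ∀ a, 0 ≤ f a) (h1 : ∀ a, f a ≤ 1)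
    (z : Fin n → ℕ) (k : Fin n) (a : ℕ) :
    |sampleMean f (Function.update z k a) - sampleMean f z| ≤ 1 / n := by
  have e : sampleMean f (Function.update z k a) - sampleMean f z =
      1 / n * (f a - f (z k)) := by
    rw [sampleMean, sampleMean, ← mul_sub, ← Finset.sum_sub_distrib, Finset.sum_eq_single k]
    · simp
    · intro i _ hi
      simp [hi]
    · simp
  have h2 : |f a - f (z k)| ≤ 1 :=
    abs_le.2 ⟨by linarith [h0 a, h1 (z k)], by linarith [h1 a, h0 (z k)]⟩
  rw [e, abs_mul, abs_of_nonneg (by positivity)]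
  exact mul_le_of_le_one_right (by positivity) h2

variable {f : ι → ℕ → ℝ} {r : ι → ℝ}

theorem abs_sub_sampleMean_le_one (h0 : ∀ j a, 0 ≤ f j a) (h1 : ∀ j a, f j a ≤ 1)
    (hr0 : ∀ j, 0 ≤ r j) (hr1 : ∀ j, r j ≤ 1) (j : ι) (z : Fin n → ℕ) :
    |r j - sampleMean (f j) z| ≤ 1 :=
  abs_le.2 ⟨by linarith [hr0 j, sampleMean_le_one (h1 j) z],
    by linarith [hr1 j, sampleMean_nonneg (h0 j) z]⟩

theorem maxDeviation_nonneg (f : ι → ℕ → ℝ) (r : ι → ℝ) (z : Fin n → ℕ) :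
    0 ≤ maxDeviation f r z :=
  Real.iSup_nonneg fun _ => abs_nonneg _

theorem maxDeviation_le_one (h0 : ∀ j a, 0 ≤ f j a) (h1 : ∀ j a, f j a ≤ 1)
    (hr0 : ∀ j, 0 ≤ r j) (hr1 : ∀ j, r j ≤ 1) (z : Fin n → ℕ) : |maxDeviation f r z| ≤ 1 := by
  rw [abs_of_nonneg (maxDeviation_nonneg f r z)]
  exact Real.iSup_le (fun j => abs_sub_sampleMean_le_one h0 h1 hr0 hr1 j z) zero_le_one

/-- Altering one observation moves every sample mean of a [0,1]-valued function by at most 1/n,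
uniformly in the index, and this passes to the supremum. -/
theorem hammingLipschitz_maxDeviation (h0 : ∀ j a, 0 ≤ f j a) (h1 : ∀ j a, f j a ≤ 1)
    (hr0 : ∀ j, 0 ≤ r j) (hr1 : ∀ j, r j ≤ 1) :
    HammingLipschitz (1 / n) (maxDeviation f r : (Fin n → ℕ) → ℝ) := fun z k a => by
  refine Real.iSup_le (fun j => ?_)
    (add_nonneg (maxDeviation_nonneg f r z) (by positivity))
  have h := le_ciSup (f := fun j => |r j - sampleMean (f j) z|)
    ⟨1, by rintro _ ⟨j, rfl⟩; exact abs_sub_sampleMean_le_one h0 h1 hr0 hr1 j z⟩ j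
  have h2 := abs_sampleMean_update_sub_le (h0 j) (h1 j) z k a
  rw [abs_sub_comm] at h2
  have h3 := abs_add_le (r j - sampleMean (f j) z)
    (sampleMean (f j) z - sampleMean (f j) (Function.update z k a))
  rw [sub_add_sub_cancel] at h3
  exact h3.trans (add_le_add h h2)

/-- The empirical law of a sample. -/
noncomputable def empiricalLaw (hn : 1 ≤ n) (z : Fin n → ℕ) : PMF ℕ :=
  haveI : Nonempty (Fin n) := ⟨⟨0, hn⟩⟩
  (PMF.uniformOfFintype (Fin n)).map z

theorem mean_empiricalLaw (hn : 1 ≤ n) (z : Fin n → ℕ) {f : ℕ → ℝ} {C : ℝ}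
    (hf : ∀ a, |f a| ≤ C) : (empiricalLaw hn z).mean f = sampleMean f z := by
  rw [empiricalLaw, PMF.mean_map _ _ hf, PMF.mean, tsum_fintype, sampleMean, Finset.mul_sum]
  simp

end Deviation

/-- The frequency deviation at `y` of a sample from `ρ`. -/
noncomputable def freqDeviation {n : ℕ} (ρ : PMF ℕ) (y : ℕ) (z : Fin n → ℕ) : ℝ :=
  (ρ y).toReal - sampleMean (fun a => if a = y then 1 else 0) z

section FreqDeviation

variable {n : ℕ} (ρ : PMF ℕ)

theorem freqDeviation_eq (hn : 1 ≤ n) (y : ℕ) (z : Fin n → ℕ) :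
    freqDeviation ρ y z = -(1 / (n : ℝ)) * ∑ i, centeredIndicator ρ y (z i) := by
  have hn0 : (n : ℝ) ≠ 0 := by exact_mod_cast (by omega : n ≠ 0)
  simp only [freqDeviation, sampleMean, centeredIndicator, Finset.sum_sub_distrib,
    Finset.sum_const, Finset.card_univ, Fintype.card_fin, nsmul_eq_mul]
  field_simp
  ring

theorem ite_one_zero_nonneg (P : Prop) [Decidable P] : (0 : ℝ) ≤ if P then 1 else 0 := by
  split_ifs <;> simp

theorem ite_one_zero_le_one (P : Prop) [Decidable P] : (if P then 1 else 0 : ℝ) ≤ 1 := by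
  split_ifs <;> simp

theorem abs_freqDeviation_le_one (y : ℕ) (z : Fin n → ℕ) : |freqDeviation ρ y z| ≤ 1 :=
  abs_sub_sampleMean_le_one (f := fun y a => if a = y then 1 else 0)
    (fun _ _ => ite_one_zero_nonneg _) (fun _ _ => ite_one_zero_le_one _)
    (fun _ => ENNReal.toReal_nonneg) ρ.toReal_le_one y z

/-- This is |ρ_y - ρ̂_y| ≤ ρ_y + ρ̂_y, written affinely in the deviation because the deviation has
mean zero under stationarity. -/
theorem abs_freqDeviation_le (y : ℕ) (z : Fin n → ℕ) :
    |freqDeviation ρ y z| ≤ 2 * (ρ y).toReal - freqDeviation ρ y z := by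
  have h : 0 ≤ sampleMean (fun a => if a = y then 1 else 0) z :=
    sampleMean_nonneg (fun _ => ite_one_zero_nonneg _) z
  have h0 : 0 ≤ (ρ y).toReal := ENNReal.toReal_nonneg
  rw [freqDeviation, abs_le]
  constructor <;> linarith

theorem ofReal_maxDeviation_sq_le (z : Fin n → ℕ) :
    ENNReal.ofReal (maxDeviation (fun y a => if a = y then 1 else 0)
      (fun y => (ρ y).toReal) z ^ 2) ≤ ∑' y, ENNReal.ofReal (freqDeviation ρ y z ^ 2) := by
  rcases eq_or_ne (∑' y, ENNReal.ofReal (freqDeviation ρ y z ^ 2)) ∞ with h | h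
  · rw [h]
    exact le_top
  · rw [ENNReal.ofReal_le_iff_le_toReal h]
    set T := (∑' y, ENNReal.ofReal (freqDeviation ρ y z ^ 2)).toReal
    have hT : 0 ≤ T := ENNReal.toReal_nonneg
    refine (Real.le_sqrt (maxDeviation_nonneg _ _ _) hT).1
      (Real.iSup_le (fun y => Real.abs_le_sqrt ?_) (Real.sqrt_nonneg _))
    exact (ENNReal.ofReal_le_iff_le_toReal h).1 (ENNReal.le_tsum y)

/-- The sample frequency of a set is its probability under the empirical law, so every set deviates
by at most the total variation distance between ρ and that law. -/
theorem ofReal_maxDeviation_sets_le (hn : 1 ≤ n) (z : Fin n → ℕ) :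
    ENNReal.ofReal (maxDeviation (fun (E : Set ℕ) a => E.indicator (fun _ => 1) a)
      (fun E => ρ.toMeasure.real E) z) ≤
      ∑' y, ENNReal.ofReal (1 / 2 * |freqDeviation ρ y z|) := by
  have hd : ∀ y, freqDeviation ρ y z = (ρ y).toReal - (empiricalLaw hn z y).toReal := fun y => by
    rw [freqDeviation, ← PMF.mean_ite_eq (empiricalLaw hn z),
      mean_empiricalLaw hn z fun a => abs_ite_le_one _]
  have hs : Summable fun y => |freqDeviation ρ y z| := by
    simp only [hd]
    exact (ρ.summable_toReal.sub (empiricalLaw hn z).summable_toReal).abs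
  rw [← ENNReal.ofReal_tsum_of_nonneg (fun y => by positivity) (hs.mul_left _), tsum_mul_left]
  simp only [hd]
  refine ENNReal.ofReal_le_ofReal (Real.iSup_le (fun E => ?_) (by positivity))
  have h0 : ∀ a, (0 : ℝ) ≤ E.indicator (fun _ => 1) a :=
    fun a => Set.indicator_nonneg (fun _ _ => zero_le_one) a
  have h1 : ∀ a, E.indicator (fun _ => (1 : ℝ)) a ≤ 1 :=
    fun a => Set.indicator_le' (fun _ _ => le_rfl) (fun _ _ => zero_le_one) a
  have := PMF.abs_mean_sub_mean_le ρ (empiricalLaw hn z) (f := E.indicator 1) h0 h1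
  rw [mean_empiricalLaw hn z (f := E.indicator 1) (C := 1) fun a => (abs_of_nonneg (h0 a)).trans_le (h1 a),
    one_mul] at this
  rw [← ρ.toMeasure_real_eq_mean] at this
  exact this

end FreqDeviation

/-! ### Expected deviations, change of initial law, and conclusion. -/

namespace GeometricallyErgodic

variable {A : ℕ → PMF ℕ} {π : PMF ℕ} {G θ : ℝ} {n : ℕ}

theorem one_add_div_nonneg (hA : GeometricallyErgodic A π G θ) (n : ℕ) :
    0 ≤ (1 + 2 * G * θ) / (n * (1 - θ)) := by
  obtain ⟨-, hG, h0, h1, -⟩ := hA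
  have : 0 ≤ G := by linarith
  have : 0 < 1 - θ := by linarith
  positivity

theorem mean_freqDeviation (hA : GeometricallyErgodic A π G θ) (B : ℕ → PMF ℕ) (hn : 1 ≤ n)
    (y : ℕ) : (obsLaw A B n π).mean (freqDeviation (π.bind B) y) = 0 := by
  simp only [funext (freqDeviation_eq (π.bind B) hn y), PMF.mean_const_mul,
    mean_obsLaw_centered hA.1.1, mul_zero]

theorem mean_freqDeviation_sq_le (hA : GeometricallyErgodic A π G θ) (B : ℕ → PMF ℕ) (hn : 1 ≤ n)
    (y : ℕ) : ((obsLaw A B n π).mean fun z => freqDeviation (π.bind B) y z ^ 2) ≤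
      (1 + 2 * G * θ) / (n * (1 - θ)) * ((π.bind B) y).toReal := by
  have hn0 : (0 : ℝ) < n := by exact_mod_cast hn
  have hθ1 : 0 < 1 - θ := by linarith [hA.2.2.2.1]
  simp only [freqDeviation_eq (π.bind B) hn y, mul_pow, PMF.mean_const_mul]
  refine (mul_le_mul_of_nonneg_left (hA.mean_obsLaw_sq_le B y n) (by positivity)).trans ?_
  rw [← sub_nonneg]
  -- The variance bound has numerator 1 - θ + 2Gθ; dropping -θ leaves the slack computed here.
  have e : (1 + 2 * G * θ) / (n * (1 - θ)) * ((π.bind B) y).toReal - (-(1 / (n : ℝ))) ^ 2 *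
      (n * (((π.bind B) y).toReal * (1 + 2 * (G * θ / (1 - θ))))) =
      ((π.bind B) y).toReal * (θ / (n * (1 - θ))) := by
    field_simp
    ring
  rw [e]
  have := hA.2.2.1
  positivity

/-- The squared supremum is at most the sum of squared deviations, whose means add up to V Σ ρ_y =
V; Cauchy–Schwarz then returns to the first moment. -/
theorem mean_maxDeviation_le (hA : GeometricallyErgodic A π G θ) (B : ℕ → PMF ℕ) (hn : 1 ≤ n) :
    (obsLaw A B n π).mean (maxDeviation (fun y a => if a = y then 1 else 0)
      (fun y => ((π.bind B) y).toReal)) ≤ √((1 + 2 * G * θ) / (n * (1 - θ))) := by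
  set V := (1 + 2 * G * θ) / (n * (1 - θ)) with hV
  have hV0 : 0 ≤ V := hA.one_add_div_nonneg n
  set ρ := π.bind B with hρ
  set F : (Fin n → ℕ) → ℝ := maxDeviation (fun y a => if a = y then 1 else 0)
      (fun y => (ρ y).toReal) with hF
  have hb : ∀ z, |F z| ≤ 1 := maxDeviation_le_one (fun _ _ => ite_one_zero_nonneg _)
    (fun _ _ => ite_one_zero_le_one _) (fun y => ENNReal.toReal_nonneg) ρ.toReal_le_one
  have habs : (fun z => |F z|) = F := funext fun z => abs_of_nonneg (maxDeviation_nonneg _ _ z)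
  have h1 := (obsLaw A B n π).mean_abs_le_sqrt hb
  rw [habs] at h1
  refine h1.trans (Real.sqrt_le_sqrt ?_)
  rw [← ENNReal.ofReal_le_ofReal_iff hV0]
  refine (ENNReal.ofReal_mean_le_tsum (g := fun y z => freqDeviation ρ y z ^ 2) _ (C := 1) (D := 1)
    (fun z => ?_) (fun z => sq_nonneg _) (fun y z => ?_) (fun y z => sq_nonneg _)
    (ofReal_maxDeviation_sq_le ρ)).trans ?_
  · rw [abs_pow]
    exact pow_le_one₀ (abs_nonneg _) (hb z)
  · rw [abs_pow]
    exact pow_le_one₀ (abs_nonneg _) (abs_freqDeviation_le_one ρ y z)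
  · calc _ ≤ ∑' y, ENNReal.ofReal V * ρ y := ENNReal.tsum_le_tsum fun y => by
          rw [← ENNReal.ofReal_toReal (ρ.apply_ne_top y), ← ENNReal.ofReal_mul hV0]
          exact ENNReal.ofReal_le_ofReal (hA.mean_freqDeviation_sq_le B hn y)
      _ = ENNReal.ofReal V := by rw [ENNReal.tsum_mul_left, ρ.tsum_coe, mul_one]

theorem mean_abs_freqDeviation_le_sqrt (hA : GeometricallyErgodic A π G θ) (B : ℕ → PMF ℕ)
    (hn : 1 ≤ n) (y : ℕ) :
    ENNReal.ofReal ((obsLaw A B n π).mean fun z => 1 / 2 * |freqDeviation (π.bind B) y z|) ≤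
      ENNReal.ofReal (gammaCoeff G θ n) * ENNReal.ofReal (√((π.bind B) y).toReal) := by
  rw [← ENNReal.ofReal_mul (by unfold gammaCoeff; positivity), PMF.mean_const_mul, gammaCoeff,
    mul_assoc, ← Real.sqrt_mul (hA.one_add_div_nonneg n)]
  refine ENNReal.ofReal_le_ofReal (mul_le_mul_of_nonneg_left ?_ (by norm_num))
  exact ((obsLaw A B n π).mean_abs_le_sqrt (abs_freqDeviation_le_one _ y)).trans
    (Real.sqrt_le_sqrt (hA.mean_freqDeviation_sq_le B hn y))

theorem mean_abs_freqDeviation_le (hA : GeometricallyErgodic A π G θ) (B : ℕ → PMF ℕ)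
    (hn : 1 ≤ n) (y : ℕ) :
    ENNReal.ofReal ((obsLaw A B n π).mean fun z => 1 / 2 * |freqDeviation (π.bind B) y z|) ≤
      (π.bind B) y := by
  rw [← ENNReal.ofReal_toReal ((π.bind B).apply_ne_top y)]
  refine ENNReal.ofReal_le_ofReal ?_
  have hb : ∀ z : Fin n → ℕ, |freqDeviation (π.bind B) y z| ≤ 1 := abs_freqDeviation_le_one _ y
  have h := PMF.mean_mono (obsLaw A B n π)
    (f := fun z => |freqDeviation (π.bind B) y z|)
    (g := fun z => 2 * ((π.bind B) y).toReal - freqDeviation (π.bind B) y z)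
    (C := 1) (C' := |2 * ((π.bind B) y).toReal| + 1) (by simpa using hb)
    (fun z => (abs_sub _ _).trans (add_le_add le_rfl (hb z)))
    (abs_freqDeviation_le _ y)
  rw [PMF.mean_sub _ (fun _ => le_rfl) hb, PMF.mean_const, hA.mean_freqDeviation B hn] at h
  rw [PMF.mean_const_mul]
  linarith

theorem mean_maxDeviation_sets_le (hA : GeometricallyErgodic A π G θ) (B : ℕ → PMF ℕ)
    (hn : 1 ≤ n) :
    ENNReal.ofReal ((obsLaw A B n π).mean (maxDeviation
      (fun (E : Set ℕ) a => E.indicator (fun _ => 1) a) (fun E => (π.bind B).toMeasure.real E))) ≤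
      chernoffRate G θ n (π.bind B) := by
  set ρ := π.bind B with hρ
  have h0 : ∀ (E : Set ℕ) a, (0 : ℝ) ≤ E.indicator (fun _ => 1) a :=
    fun E a => Set.indicator_nonneg (fun _ _ => zero_le_one) a
  have h1 : ∀ (E : Set ℕ) a, E.indicator (fun _ => (1 : ℝ)) a ≤ 1 :=
    fun E a => Set.indicator_le' (fun _ _ => le_rfl) (fun _ _ => zero_le_one) a
  have hb : ∀ (y : ℕ) (z : Fin n → ℕ), |(1 / 2 * |freqDeviation ρ y z|)| ≤ 1 := fun y z => by
    rw [abs_of_nonneg (by positivity)]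
    linarith [abs_freqDeviation_le_one ρ y z]
  set F : (Fin n → ℕ) → ℝ := maxDeviation (fun (E : Set ℕ) a => E.indicator (fun _ => 1) a)
    (fun E => ρ.toMeasure.real E) with hF
  have hFb : ∀ z, |F z| ≤ 1 := maxDeviation_le_one h0 h1
    (fun E => measureReal_nonneg) (fun E => measureReal_le_one)
  have hle : ENNReal.ofReal ((obsLaw A B n π).mean F) ≤ ∑' y, ENNReal.ofReal
      ((obsLaw A B n π).mean fun z => 1 / 2 * |freqDeviation ρ y z|) :=
    ENNReal.ofReal_mean_le_tsum (g := fun y z => 1 / 2 * |freqDeviation ρ y z|) _ hFb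
      (maxDeviation_nonneg _ _) hb (fun y z => by positivity) (ofReal_maxDeviation_sets_le ρ hn)
  refine hle.trans ?_
  have hc : {y | (n : ℝ≥0∞)⁻¹ ≤ ρ y}ᶜ = {y | ρ y < (n : ℝ≥0∞)⁻¹} := by
    ext y
    simp
  have hsplit := ENNReal.summable.tsum_add_tsum_compl
    (f := fun y => ENNReal.ofReal ((obsLaw A B n π).mean fun z => 1 / 2 * |freqDeviation ρ y z|))
    (s := {y | (n : ℝ≥0∞)⁻¹ ≤ ρ y}) ENNReal.summable
  rw [hc] at hsplit
  rw [← hsplit]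
  unfold chernoffRate
  -- Frequent values use the variance bound; for the rare ones each of the two bounds is summed
  -- separately, giving the minimum of the sums.
  refine add_le_add ?_ (le_min ?_ ?_)
  · rw [← ENNReal.tsum_mul_left]
    exact ENNReal.tsum_le_tsum fun y => hA.mean_abs_freqDeviation_le_sqrt B hn y
  · rw [← ENNReal.tsum_mul_left]
    exact ENNReal.tsum_le_tsum fun y => hA.mean_abs_freqDeviation_le_sqrt B hn y
  · exact ENNReal.tsum_le_tsum fun y => hA.mean_abs_freqDeviation_le B hn y

theorem real_le {Ω : Type*} [MeasurableSpace Ω] {P : Measure Ω}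
    {Y : ℕ → Ω → ℕ} {B : ℕ → PMF ℕ} {π' : PMF ℕ} (hA : GeometricallyErgodic A π G θ)
    (hY : IsHiddenMarkovChain P Y π' A B) (hn : 1 ≤ n) {ε : ℝ} (hε : 0 < ε)
    {F : (Fin n → ℕ) → ℝ} {C : ℝ} (hF : ∀ z, |F z| ≤ C) (hL : HammingLipschitz (1 / n) F)
    {S : Set (Fin n → ℕ)} (hS : ∀ z ∈ S, (obsLaw A B n π).mean F + ε ≤ F z) :
    P.real {ω | (fun i : Fin n => Y i ω) ∈ S} ≤
      Real.exp (-(n * (1 - θ) ^ 2 * ε ^ 2 / (2 * G ^ 2))) + tvDist π π' := by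
  have h1 := hA.obsLaw_tail_le B hn π hF hL hε hS
  have h2 := abs_mean_obsLaw_sub_le (A := A) (B := B) π π' (F := S.indicator 1) (c := 1)
    (fun z => Set.indicator_nonneg (fun _ _ => zero_le_one) z)
    (fun z => Set.indicator_le' (fun _ _ => le_rfl) (fun _ _ => zero_le_one) z)
  rw [hY.real_eq_mean hn]
  linarith [(abs_le.1 h2).1]

end GeometricallyErgodic

theorem mainTheorem5 {Ω : Type*} [MeasurableSpace Ω] (P : Measure Ω) [IsProbabilityMeasure P]
    (Y : ℕ → Ω → ℕ) (A B : ℕ → PMF ℕ) (π π' : PMF ℕ) (G θ : ℝ)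
    (hA : GeometricallyErgodic A π G θ)
    (hY : IsHiddenMarkovChain P Y π' A B)
    (n : ℕ) (hn : 1 ≤ n) (ε : ℝ) (hε : 0 < ε) :
    P.real {ω | √((1 + 2 * G * θ) / (n * (1 - θ))) + ε <
          ⨆ y : ℕ, |((π.bind B) y).toReal - empiricalFreq Y n ω y|}
        ≤ Real.exp (-(n * (1 - θ) ^ 2 * ε ^ 2 / (2 * G ^ 2))) + tvDist π π' ∧
      P.real {ω | chernoffRate G θ n (π.bind B) + ENNReal.ofReal ε <
          ENNReal.ofReal
            (⨆ E : Set ℕ, |(π.bind B).toMeasure.real E - occupationFreq Y n ω E|)}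
        ≤ Real.exp (-(n * (1 - θ) ^ 2 * ε ^ 2 / (2 * G ^ 2))) + tvDist π π' := by
  set ρ := π.bind B with hρ
  constructor
  · have e : ∀ ω, (⨆ y : ℕ, |(ρ y).toReal - empiricalFreq Y n ω y|) =
        maxDeviation (fun y a => if a = y then 1 else 0) (fun y => (ρ y).toReal)
          (fun i : Fin n => Y i ω) := fun ω => by
      simp only [empiricalFreq, maxDeviation, sampleMean, Finset.sum_range]
    simp only [e]
    refine hA.real_le hY hn hε
      (maxDeviation_le_one (f := fun y a => if a = y then 1 else 0) (r := fun y => (ρ y).toReal)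
        (fun _ _ => ite_one_zero_nonneg _) (fun _ _ => ite_one_zero_le_one _) (fun y => ENNReal.toReal_nonneg)
        ρ.toReal_le_one)
      (hammingLipschitz_maxDeviation (fun _ _ => ite_one_zero_nonneg _) (fun _ _ => ite_one_zero_le_one _)
        (fun y => ENNReal.toReal_nonneg) ρ.toReal_le_one)
      (S := {z | √((1 + 2 * G * θ) / (n * (1 - θ))) + ε <
        maxDeviation (fun y a => if a = y then 1 else 0) (fun y => (ρ y).toReal) z})
      fun z hz => ?_
    exact (add_le_add (hA.mean_maxDeviation_le B hn) le_rfl).trans (le_of_lt hz)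
  · have e : ∀ ω, (⨆ E : Set ℕ, |ρ.toMeasure.real E - occupationFreq Y n ω E|) =
        maxDeviation (fun (E : Set ℕ) a => E.indicator (fun _ => 1) a)
          (fun E => ρ.toMeasure.real E) (fun i : Fin n => Y i ω) := fun ω => by
      simp only [occupationFreq, maxDeviation, sampleMean, Finset.sum_range]
    have h0 : ∀ (E : Set ℕ) a, (0 : ℝ) ≤ E.indicator (fun _ => 1) a :=
      fun E a => Set.indicator_nonneg (fun _ _ => zero_le_one) a
    have h1 : ∀ (E : Set ℕ) a, E.indicator (fun _ => (1 : ℝ)) a ≤ 1 :=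
      fun E a => Set.indicator_le' (fun _ _ => le_rfl) (fun _ _ => zero_le_one) a
    simp only [e]
    refine hA.real_le hY hn hε
      (maxDeviation_le_one h0 h1 (r := fun E => ρ.toMeasure.real E)
        (fun E => measureReal_nonneg) (fun E => measureReal_le_one))
      (hammingLipschitz_maxDeviation h0 h1 (fun E => measureReal_nonneg)
        (fun E => measureReal_le_one))
      (S := {z | chernoffRate G θ n ρ + ENNReal.ofReal ε < ENNReal.ofReal
        (maxDeviation (fun (E : Set ℕ) a => E.indicator (fun _ => 1) a)
          (fun E => ρ.toMeasure.real E) z)})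
      fun z hz => ?_
    have h2 := (add_le_add_left (hA.mean_maxDeviation_sets_le B hn) (ENNReal.ofReal ε)).trans
      (le_of_lt hz)
    -- Both sides are now `ENNReal.ofReal` of real quantities, so the bound by Λ_n(ρ), stated in [0,
    -- ∞], yields the real inequality.
    rw [← ENNReal.ofReal_add (PMF.mean_nonneg _ (maxDeviation_nonneg _ _)) hε.le] at h2
    exact (ENNReal.ofReal_le_ofReal_iff (maxDeviation_nonneg _ _ z)).1 h2
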